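/- Let $n$ be a natural number. Let $\mathcal{MB}_n$ be the monoid of positive braids on $n$ strands, i.e. the monoid with generators $x_1,\dots,x_{n-1}$ and relations $x_ix_j=x_jx_i$ for $|i-j|\neq 1$ and $x_{i+1}x_ix_{i+1}=x_ix_{i+1}x_i$, and let $\mathcal{B}_n$ be the braid group, i.e. the group with the same presentation. An element of $\mathcal{MB}_n$ is called literally simple if it is represented by a word in $x_1,\dots,x_{n-1}$ in which no letter occurs twice; it is called square free if it is not of the form $\delta x_i^2\varepsilon$ with $\delta,\varepsilon\in\mathcal{MB}_n$ and $1\le i\le n-1$; and it is called conjugate simple if every $\beta'\in\mathcal{MB}_n$ which is conjugate to it in $\mathcal{B}_n$ is square free. Let $\mathcal{LSB}_n$ and $\mathcal{CSB}_n$ be the sets of literally simple and of conjugate simple elements of $\mathcal{MB}_n$. 1. Let $\alpha\in\mathcal{LSB}_n$ and $\beta,\delta\in\mathcal{MB}_n$. (a) If $\alpha\beta=\beta\delta$, then $\delta\in\mathcal{LSB}_n$. (b) If $\beta\alpha=\delta\beta$, then $\delta\in\mathcal{LSB}_n$. 2. $\mathcal{LSB}_n=\mathcal{CSB}_n$; that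 is, a positive braid is literally simple if and only if all the positive braids conjugate to it are square free. -/

import Mathlib

namespace SimpleBraids

/-- Artin's defining relations between the generators `x_1, …, x_{n-1}` of the braids on `n`
strands; the generator `x_{i+1}` is indexed by `i : Fin (n - 1)`. -/
inductive ArtinRel (n : ℕ) : FreeMonoid (Fin (n - 1)) → FreeMonoid (Fin (n - 1)) → Prop
  | comm (i j : Fin (n - 1)) (hij : (i : ℕ) + 1 ≠ j) (hji : (j : ℕ) + 1 ≠ i) :
      ArtinRel n (FreeMonoid.of i * FreeMonoid.of j) (FreeMonoid.of j * FreeMonoid.of i)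
  | braid (i j : Fin (n - 1)) (hij : (i : ℕ) + 1 = j) :
      ArtinRel n (FreeMonoid.of j * FreeMonoid.of i * FreeMonoid.of j)
        (FreeMonoid.of i * FreeMonoid.of j * FreeMonoid.of i)

/-- The monoid `MB_n` of positive braids on `n` strands. -/
abbrev BraidMonoid (n : ℕ) : Type := PresentedMonoid (ArtinRel n)

/-- The natural projection from the free monoid on `x_1, …, x_{n-1}` to `MB_n`. -/
abbrev proj (n : ℕ) : FreeMonoid (Fin (n - 1)) →* BraidMonoid n := PresentedMonoid.mk (ArtinRel n)

/-- The generators of the braid monoid. -/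
abbrev gen {n : ℕ} (i : Fin (n - 1)) : BraidMonoid n := PresentedMonoid.of (ArtinRel n) i

/-- The Artin relations, written as relators in the free group. -/
def artinRelators (n : ℕ) : Set (FreeGroup (Fin (n - 1))) :=
  {r | ∃ u v, ArtinRel n u v ∧
    r = FreeMonoid.lift FreeGroup.of u * (FreeMonoid.lift FreeGroup.of v)⁻¹}

/-- The Artin braid group `B_n` on `n` strands. -/
abbrev BraidGroup (n : ℕ) : Type := PresentedGroup (artinRelators n)

theorem lift_of_eq_mk (n : ℕ) (w : FreeMonoid (Fin (n - 1))) :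
    FreeMonoid.lift (fun i => (PresentedGroup.of i : BraidGroup n)) w =
      PresentedGroup.mk (artinRelators n) (FreeMonoid.lift FreeGroup.of w) := by
  induction w with
  | one => simp
  | of i => simp [PresentedGroup.of]
  | mul u v hu hv => simp [hu, hv]

theorem lift_eq_of_artinRel (n : ℕ) (u v : FreeMonoid (Fin (n - 1))) (h : ArtinRel n u v) :
    FreeMonoid.lift (fun i => (PresentedGroup.of i : BraidGroup n)) u =
      FreeMonoid.lift (fun i => (PresentedGroup.of i : BraidGroup n)) v := by
  rw [lift_of_eq_mk, lift_of_eq_mk, ← mul_inv_eq_one, ← map_inv, ← map_mul]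
  exact (QuotientGroup.eq_one_iff _).2 (Subgroup.subset_normalClosure ⟨u, v, h, rfl⟩)

/-- The canonical homomorphism `MB_n → B_n`, sending generators to generators. -/
def toBraidGroup (n : ℕ) : BraidMonoid n →* BraidGroup n :=
  PresentedMonoid.lift (fun i => PresentedGroup.of i) (lift_eq_of_artinRel n)

/-- A simple word: no letter occurs twice. -/
def IsSimpleWord {n : ℕ} (w : FreeMonoid (Fin (n - 1))) : Prop := w.toList.Nodup

/-- A positive braid is literally simple if it is represented by a simple word. -/
def IsLiterallySimple {n : ℕ} (α : BraidMonoid n) : Prop :=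
  ∃ w : FreeMonoid (Fin (n - 1)), IsSimpleWord w ∧ proj n w = α

/-- `α` divides `β` in the braid monoid: `β = δ α ε` with positive braids `δ` and `ε`. -/
def Divides {n : ℕ} (α β : BraidMonoid n) : Prop :=
  ∃ δ ε : BraidMonoid n, β = δ * α * ε

/-- A positive braid is square free if no square of a generator divides it. -/
def IsSquareFree {n : ℕ} (β : BraidMonoid n) : Prop :=
  ¬ ∃ i : Fin (n - 1), Divides (gen i ^ 2) β

/-- A positive braid is conjugate simple if all the positive braids that are conjugate to it
in the braid group are square free. -/
def IsConjugateSimple {n : ℕ} (β : BraidMonoid n) : Prop :=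
  ∀ β' : BraidMonoid n, IsConj (toBraidGroup n β) (toBraidGroup n β') → IsSquareFree β'

/-- The set `LSB_n` of literally simple braids. -/
def LSB (n : ℕ) : Set (BraidMonoid n) := {α | IsLiterallySimple α}

/-- The set `CSB_n` of conjugate simple braids. -/
def CSB (n : ℕ) : Set (BraidMonoid n) := {β | IsConjugateSimple β}

end SimpleBraids

namespace SimpleBraids

variable {n : ℕ}

/-! Conjugacy in the braid group preserves the exponent sum and, for the strand permutation σ, the
rank of f ↦ f ∘ σ - f. On a positive word this rank is at most the number of distinct letters, with
equality to the length when the word is simple. So a positive word conjugate to a simple one has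
length = rank ≤ number of distinct letters, hence is simple (`isSimpleWord_of_isConj`). Both
cancellation-type claims follow, and so does LSB ⊆ CSB, since a word with a square is not simple.

Conversely, in a square free braid the highest generator can be made to occur at most once
(`mem_initial_or_exists_eq`). Conjugation then collects everything else on one side of it, leaving a
braid in lower generators; iterating downwards yields a simple word (`isLiterallySimple_mul`). -/

/-! ### Permutation and exponent sum -/

/-- The pair (permutation of the strands, word length) attached to a generator. -/
def genImage (i : Fin (n - 1)) : Equiv.Perm ℕ × Multiplicative ℤ :=
  (Equiv.swap (i : ℕ) (i + 1), Multiplicative.ofAdd 1)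

theorem lift_genImage_eq_of_artinRel (u v : FreeMonoid (Fin (n - 1))) (h : ArtinRel n u v) :
    FreeMonoid.lift (genImage (n := n)) u = FreeMonoid.lift genImage v := by
  cases h with
  | comm i j hij hji =>
    by_cases e : i = j
    · rw [e]
    have e' : (i : ℕ) ≠ j := fun h => e (Fin.ext h)
    simp only [map_mul, FreeMonoid.lift_eval_of, genImage]
    refine Prod.ext ?_ rfl
    refine (Equiv.Perm.Disjoint.commute ?_).eq
    intro x
    by_cases hx : x = i ∨ x = i + 1
    · right
      exact Equiv.swap_apply_of_ne_of_ne (by omega) (by omega)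
    · left
      exact Equiv.swap_apply_of_ne_of_ne (by omega) (by omega)
  | braid i j hij =>
    simp only [map_mul, FreeMonoid.lift_eval_of, genImage]
    refine Prod.ext ?_ rfl
    ext x
    simp only [Prod.mk_mul_mk, Equiv.Perm.mul_apply, ← hij, Equiv.swap_apply_def]
    grind

/-- The homomorphism from the braid group recording permutation and exponent sum. -/
def permLength (n : ℕ) : BraidGroup n →* Equiv.Perm ℕ × Multiplicative ℤ :=
  PresentedGroup.toGroup (f := genImage) (by
    rintro r ⟨u, v, h, rfl⟩
    have key : ∀ w : FreeMonoid (Fin (n - 1)),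
        FreeGroup.lift genImage (FreeMonoid.lift FreeGroup.of w) =
          FreeMonoid.lift (genImage (n := n)) w := by
      intro w
      induction w with
      | one => simp
      | of i => simp
      | mul u v hu hv => simp [hu, hv]
    rw [map_mul, map_inv, key, key, lift_genImage_eq_of_artinRel u v h, mul_inv_cancel])

theorem permLength_proj (w : FreeMonoid (Fin (n - 1))) :
    permLength n (toBraidGroup n (proj n w)) = FreeMonoid.lift genImage w := by
  induction w with
  | one => simp
  | of i =>
    change permLength n (toBraidGroup n (PresentedMonoid.of _ i)) = _
    simp [toBraidGroup, permLength]
  | mul u v hu hv => simp [hu, hv]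

/-- The permutation of the strands attached to a word. -/
def wordPerm (l : List (Fin (n - 1))) : Equiv.Perm ℕ :=
  (l.map fun i : Fin (n - 1) => Equiv.swap (i : ℕ) (i + 1)).prod

theorem lift_genImage (l : List (Fin (n - 1))) :
    FreeMonoid.lift genImage (FreeMonoid.ofList l) =
      (wordPerm l, Multiplicative.ofAdd (l.length : ℤ)) := by
  rw [FreeMonoid.lift_ofList]
  induction l with
  | nil => rfl
  | cons a l ih =>
    rw [List.map_cons, List.prod_cons, ih]
    refine Prod.ext (by simp [genImage, wordPerm]) ?_
    simp only [genImage, Prod.mk_mul_mk, List.length_cons, ← ofAdd_add]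
    congr 1
    push_cast
    ring

/-! ### The rank of the displacement as a conjugacy invariant -/

/-- The displacement `f ↦ f ∘ σ - f` of the permutation representation. -/
def displacement (σ : Equiv.Perm ℕ) : (ℕ → ℚ) →ₗ[ℚ] (ℕ → ℚ) :=
  LinearMap.funLeft ℚ ℚ σ - LinearMap.id

theorem mem_ker_displacement {σ : Equiv.Perm ℕ} {f : ℕ → ℚ} :
    f ∈ LinearMap.ker (displacement σ) ↔ ∀ x, f (σ x) = f x := by
  simp [displacement, LinearMap.mem_ker, funext_iff, sub_eq_zero, LinearMap.funLeft_apply]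

theorem finrank_range_displacement_of_isConj {σ τ : Equiv.Perm ℕ} (h : IsConj σ τ) :
    Module.finrank ℚ (LinearMap.range (displacement σ)) =
      Module.finrank ℚ (LinearMap.range (displacement τ)) := by
  obtain ⟨c, rfl⟩ := isConj_iff.1 h
  have e : displacement (c * σ * c⁻¹) =
      (LinearEquiv.funCongrLeft ℚ ℚ c).symm.toLinearMap ∘ₗ displacement σ ∘ₗ
        (LinearEquiv.funCongrLeft ℚ ℚ c).toLinearMap := by
    ext f x
    simp [displacement, LinearMap.funLeft_apply, LinearEquiv.funCongrLeft]
  rw [e, LinearMap.range_comp, LinearEquiv.finrank_map_eq, LinearMap.range_comp_of_range_eq_top]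
  exact LinearEquiv.range _

/-- The jumps of a function across the generators in `S`. -/
def jumps (S : Finset (Fin (n - 1))) : (ℕ → ℚ) →ₗ[ℚ] (S → ℚ) :=
  LinearMap.pi fun i => (LinearMap.proj (((i : Fin (n - 1)) : ℕ) + 1) : (ℕ → ℚ) →ₗ[ℚ] ℚ) -
    LinearMap.proj ((i : Fin (n - 1)) : ℕ)

theorem jumps_apply (S : Finset (Fin (n - 1))) (f : ℕ → ℚ) (i : S) :
    jumps S f i = f (((i : Fin (n - 1)) : ℕ) + 1) - f ((i : Fin (n - 1)) : ℕ) := rfl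

theorem mem_ker_jumps {S : Finset (Fin (n - 1))} {f : ℕ → ℚ} :
    f ∈ LinearMap.ker (jumps S) ↔ ∀ i ∈ S, f ((i : ℕ) + 1) = f i := by
  simp [LinearMap.mem_ker, funext_iff, jumps_apply, sub_eq_zero]

theorem jumps_surjective (S : Finset (Fin (n - 1))) : Function.Surjective (jumps S) := by
  intro t
  -- Partial sums of the prescribed jumps, with jump 0 at positions outside `S`.
  refine ⟨fun j => ∑ k ∈ Finset.range j,
    if h : ∃ i : S, ((i : Fin (n - 1)) : ℕ) = k then t h.choose else 0, ?_⟩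
  ext i
  rw [jumps_apply, Finset.sum_range_succ, add_sub_cancel_left]
  have h : ∃ i' : S, ((i' : Fin (n - 1)) : ℕ) = ((i : Fin (n - 1)) : ℕ) := ⟨i, rfl⟩
  rw [dif_pos h]
  congr 1
  exact Subtype.ext (Fin.ext h.choose_spec)

theorem ker_jumps_le_ker_displacement (l : List (Fin (n - 1))) :
    LinearMap.ker (jumps l.toFinset) ≤ LinearMap.ker (displacement (wordPerm l)) := by
  intro f
  rw [mem_ker_jumps, mem_ker_displacement]
  induction l with
  | nil => simp [wordPerm]
  | cons a l ih =>
    intro h x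
    rw [← ih (fun i hi => h i (by simp_all)) x]
    have ha := h a (by simp)
    simp only [wordPerm, List.map_cons, List.prod_cons, Equiv.Perm.mul_apply,
      Equiv.swap_apply_def]
    grind

/-- The function space is infinite-dimensional, so the two ranks are compared through the quotients
by the kernels. -/
theorem finrank_range_displacement_le (l : List (Fin (n - 1))) :
    Module.finrank ℚ (LinearMap.range (displacement (wordPerm l))) ≤ l.toFinset.card := by
  have e := (jumps l.toFinset).quotKerEquivOfSurjective (jumps_surjective _)
  have : Module.Finite ℚ ((ℕ → ℚ) ⧸ LinearMap.ker (jumps l.toFinset)) := Module.Finite.equiv e.symm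
  have h := LinearMap.finrank_le_finrank_of_surjective
    (Submodule.factor_surjective (ker_jumps_le_ker_displacement l))
  rw [← (displacement (wordPerm l)).quotKerEquivRange.finrank_eq]
  rwa [e.finrank_eq, Module.finrank_fintype_fun_eq_card, Fintype.card_coe] at h

/-- Only the letter `a` moves a strand between {0, …, a} and its complement. -/
theorem sum_range_wordPerm (l : List (Fin (n - 1))) (a : Fin (n - 1)) (ha : a ∉ l) (f : ℕ → ℚ) :
    ∑ j ∈ Finset.range (a + 1), f (wordPerm l j) = ∑ j ∈ Finset.range (a + 1), f j := by
  induction l generalizing f with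
  | nil => simp [wordPerm]
  | cons b l ih =>
    have hab : (a : ℕ) ≠ b := fun h => ha (by simp [Fin.ext h])
    have e := ih (fun h => ha (by simp [h])) (fun x => f (Equiv.swap (b : ℕ) (b + 1) x))
    simp only [wordPerm, List.map_cons, List.prod_cons, Equiv.Perm.mul_apply] at e ⊢
    rw [e]
    refine Finset.sum_equiv (Equiv.swap (b : ℕ) (b + 1)) (fun x => ?_) (fun _ _ => rfl)
    simp only [Finset.mem_range, Equiv.swap_apply_def]
    split_ifs <;> omega

theorem ker_displacement_eq (l : List (Fin (n - 1))) (hl : l.Nodup) :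
    LinearMap.ker (displacement (wordPerm l)) = LinearMap.ker (jumps l.toFinset) := by
  refine le_antisymm (fun f => ?_) (ker_jumps_le_ker_displacement l)
  rw [mem_ker_jumps, mem_ker_displacement]
  induction l with
  | nil => simp
  | cons a l ih =>
    intro h
    rw [List.nodup_cons] at hl
    have hs : ∀ x, f (Equiv.swap (a : ℕ) (a + 1) (wordPerm l x)) = f x := by
      simpa [wordPerm] using h
    -- For invariant `f`, the sums of `f` and of `f` ∘ (a a+1) over {0, …, a} agree; they differ
    -- only in the term at `a`, which forces f (a + 1) = f a.
    have e := sum_range_wordPerm l a hl.1 (fun x => f (Equiv.swap (a : ℕ) (a + 1) x))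
    simp only [hs] at e
    have e' : ∑ j ∈ Finset.range (a : ℕ), f (Equiv.swap (a : ℕ) (a + 1) j) =
        ∑ j ∈ Finset.range (a : ℕ), f j := by
      refine Finset.sum_congr rfl fun j hj => ?_
      rw [Finset.mem_range] at hj
      rw [Equiv.swap_apply_of_ne_of_ne (by omega) (by omega)]
    rw [Finset.sum_range_succ, Finset.sum_range_succ, e', Equiv.swap_apply_left] at e
    have ha : f ((a : ℕ) + 1) = f a := by linarith
    have hfix : ∀ y, f (Equiv.swap (a : ℕ) (a + 1) y) = f y := by
      intro y
      rw [Equiv.swap_apply_def]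
      split_ifs with h1 h2
      · rw [h1, ha]
      · rw [h2, ha]
      · rfl
    simp only [hfix] at hs
    intro i hi
    rw [List.mem_toFinset, List.mem_cons] at hi
    rcases hi with rfl | hi
    · exact ha
    · exact ih hl.2 hs i (by simpa using hi)

theorem finrank_range_displacement (l : List (Fin (n - 1))) (hl : l.Nodup) :
    Module.finrank ℚ (LinearMap.range (displacement (wordPerm l))) = l.length := by
  rw [← (displacement (wordPerm l)).quotKerEquivRange.finrank_eq, ker_displacement_eq l hl,
    ((jumps l.toFinset).quotKerEquivOfSurjective (jumps_surjective _)).finrank_eq,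
    Module.finrank_fintype_fun_eq_card, Fintype.card_coe, List.toFinset_card_of_nodup hl]

/-- Every positive word representing a conjugate of a simple word is simple. -/
theorem isSimpleWord_of_isConj {u v : FreeMonoid (Fin (n - 1))} (hu : IsSimpleWord u)
    (h : IsConj (toBraidGroup n (proj n u)) (toBraidGroup n (proj n v))) : IsSimpleWord v := by
  have hc := (permLength n).map_isConj h
  rw [permLength_proj, permLength_proj, ← FreeMonoid.ofList_toList u, ← FreeMonoid.ofList_toList v,
    lift_genImage, lift_genImage] at hc
  have hperm := finrank_range_displacement_of_isConj ((MonoidHom.fst _ _).map_isConj hc)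
  have hlen := isConj_iff_eq.1 ((MonoidHom.snd _ _).map_isConj hc)
  have hlen' : u.toList.length = v.toList.length := by
    have := congrArg Multiplicative.toAdd hlen
    simpa using this
  change Module.finrank ℚ (LinearMap.range (displacement (wordPerm u.toList))) =
    Module.finrank ℚ (LinearMap.range (displacement (wordPerm v.toList))) at hperm
  rw [finrank_range_displacement _ hu, hlen'] at hperm
  have hle := hperm.trans_le (finrank_range_displacement_le v.toList)
  exact Multiset.toFinset_card_eq_card_iff_nodup.1 (le_antisymm (List.toFinset_card_le _) hle)

/-! ### Literally simple braids under conjugation -/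

theorem exists_proj_eq (β : BraidMonoid n) : ∃ w, proj n w = β := PresentedMonoid.surjective_mk β

theorem IsLiterallySimple.of_isConj {α β : BraidMonoid n} (hα : IsLiterallySimple α)
    (h : IsConj (toBraidGroup n α) (toBraidGroup n β)) : IsLiterallySimple β := by
  obtain ⟨u, hu, rfl⟩ := hα
  obtain ⟨v, rfl⟩ := exists_proj_eq β
  exact ⟨v, isSimpleWord_of_isConj hu h, rfl⟩

theorem isConj_toBraidGroup {α β δ : BraidMonoid n} (h : β * α = δ * β) :
    IsConj (toBraidGroup n α) (toBraidGroup n δ) := by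
  refine isConj_iff.2 ⟨toBraidGroup n β, ?_⟩
  rw [← map_mul, h, map_mul, mul_inv_cancel_right]

theorem IsLiterallySimple.isSquareFree {α : BraidMonoid n} (hα : IsLiterallySimple α) :
    IsSquareFree α := by
  rintro ⟨i, δ, ε, rfl⟩
  obtain ⟨u, hu, he⟩ := hα
  obtain ⟨d, rfl⟩ := exists_proj_eq δ
  obtain ⟨e, rfl⟩ := exists_proj_eq ε
  have : proj n u = proj n (d * FreeMonoid.of i ^ 2 * e) := by
    rw [he, map_mul, map_mul, map_pow]
    rfl
  have h := isSimpleWord_of_isConj hu (v := d * FreeMonoid.of i ^ 2 * e) (by rw [this])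
  simp [IsSimpleWord, pow_two, List.nodup_append] at h

theorem IsSquareFree.of_divides {α β : BraidMonoid n} (hβ : IsSquareFree β) (h : Divides α β) :
    IsSquareFree α := by
  rintro ⟨i, a, b, rfl⟩
  obtain ⟨c, d, rfl⟩ := h
  exact hβ ⟨i, c * a, b * d, by simp only [mul_assoc]⟩

theorem IsConjugateSimple.of_isConj {α β : BraidMonoid n} (hα : IsConjugateSimple α)
    (h : IsConj (toBraidGroup n α) (toBraidGroup n β)) : IsConjugateSimple β :=
  fun β' hβ' => hα β' (h.trans hβ')

/-! ### From conjugate simple to literally simple -/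

theorem gen_comm (i j : Fin (n - 1)) (hij : (i : ℕ) + 1 ≠ j) (hji : (j : ℕ) + 1 ≠ i) :
    (gen i : BraidMonoid n) * gen j = gen j * gen i :=
  (Con.eq _).2 (ConGen.Rel.of _ _ (ArtinRel.comm i j hij hji))

theorem gen_braid (i j : Fin (n - 1)) (hij : (i : ℕ) + 1 = j) :
    (gen j : BraidMonoid n) * gen i * gen j = gen i * gen j * gen i :=
  (Con.eq _).2 (ConGen.Rel.of _ _ (ArtinRel.braid i j hij))

/-- The submonoid generated by the first `k` generators. -/
def initial (n k : ℕ) : Submonoid (BraidMonoid n) :=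
  Submonoid.closure (gen '' {i : Fin (n - 1) | (i : ℕ) < k})

theorem gen_mem_initial {k : ℕ} {i : Fin (n - 1)} (h : (i : ℕ) < k) : gen i ∈ initial n k :=
  Submonoid.subset_closure ⟨i, h, rfl⟩

theorem initial_mono {k l : ℕ} (h : k ≤ l) : initial n k ≤ initial n l :=
  Submonoid.closure_mono (Set.image_mono fun _ hi => lt_of_lt_of_le hi h)

theorem initial_zero : initial n 0 = ⊥ := by simp [initial]

theorem mem_initial (β : BraidMonoid n) : β ∈ initial n (n - 1) := by
  obtain ⟨w, rfl⟩ := exists_proj_eq β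
  induction w with
  | one => simp
  | of i => exact gen_mem_initial i.2
  | mul u v hu hv => simpa using mul_mem hu hv

theorem commute_gen_of_mem_initial {k : ℕ} {a : BraidMonoid n} (ha : a ∈ initial n k)
    {i : Fin (n - 1)} (hi : k < i) : Commute (gen i) a := by
  have hle : initial n k ≤ Submonoid.centralizer {gen i} := by
    refine Submonoid.closure_le.2 ?_
    rintro _ ⟨j, hj, rfl⟩
    have hj' : (j : ℕ) < k := hj
    rw [SetLike.mem_coe, Submonoid.mem_centralizer_iff]
    rintro _ rfl
    exact gen_comm _ _ (by omega) (by omega)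
  exact Submonoid.mem_centralizer_iff.1 (hle ha) _ rfl

/-- In a square free braid the last generator can be made to occur at most once. -/
theorem mem_initial_or_exists_eq {k : ℕ} {γ : BraidMonoid n} (hγ : γ ∈ initial n (k + 1))
    (hsq : IsSquareFree γ) :
    γ ∈ initial n k ∨ ∃ h : k < n - 1, ∃ a ∈ initial n k, ∃ b ∈ initial n k,
      γ = a * gen ⟨k, h⟩ * b := by
  induction k generalizing γ with
  | zero =>
    induction hγ using Submonoid.closure_induction_right with
    | one => exact Or.inl (one_mem _)
    | mul_right γ hγ y hy ih =>
      obtain ⟨⟨i, hi⟩, hik, rfl⟩ := hy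
      obtain rfl : i = 0 := by simpa using hik
      rcases ih (hsq.of_divides ⟨1, gen ⟨0, hi⟩, by simp⟩) with h | ⟨h, a, ha, b, hb, rfl⟩
      · exact Or.inr ⟨hi, γ, h, 1, one_mem _, by simp⟩
      · obtain rfl : b = 1 := by simpa [initial_zero] using hb
        exact (hsq ⟨⟨0, hi⟩, a, 1, by simp [pow_two, mul_assoc]⟩).elim
  | succ k ihk =>
    induction hγ using Submonoid.closure_induction_right with
    | one => exact Or.inl (one_mem _)
    | mul_right γ hγ y hy ih =>
      obtain ⟨⟨i, hi⟩, hik, rfl⟩ := hy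
      have hik' : i < k + 1 + 1 := hik
      have ih' := ih (hsq.of_divides ⟨1, gen ⟨i, hi⟩, by simp⟩)
      rcases Nat.lt_succ_iff_lt_or_eq.1 hik' with hlt | rfl
      · have hm : gen ⟨i, hi⟩ ∈ initial n (k + 1) := gen_mem_initial hlt
        rcases ih' with h | ⟨h, a, ha, b, hb, rfl⟩
        · exact Or.inl (mul_mem h hm)
        · exact Or.inr ⟨h, a, ha, b * gen ⟨i, hi⟩, mul_mem hb hm, by simp only [mul_assoc]⟩
      · rcases ih' with h | ⟨h, a, ha, b, hb, rfl⟩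
        · exact Or.inr ⟨hi, γ, h, 1, one_mem _, by simp⟩
        -- Two copies of y = x_{k+1} now enclose `b`. If `b` avoids x = x_k, they commute together
        -- into a square; if x occurs once, yxy = xyx leaves a single y.
        · rcases ihk hb (hsq.of_divides
            ⟨a * gen ⟨k + 1, h⟩, gen ⟨k + 1, h⟩, by simp only [mul_assoc]⟩) with
            hb' | ⟨hk, c, hc, d, hd, rfl⟩
          · have hcomm := commute_gen_of_mem_initial hb' (i := ⟨k + 1, h⟩) (Nat.lt_succ_self k)
            refine (hsq ⟨⟨k + 1, h⟩, a, b, ?_⟩).elim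
            rw [pow_two, mul_assoc, mul_assoc, ← hcomm.eq]
            simp only [mul_assoc]
          · have hcc := (commute_gen_of_mem_initial hc (i := ⟨k + 1, h⟩) (Nat.lt_succ_self k)).eq
            have hcd := (commute_gen_of_mem_initial hd (i := ⟨k + 1, h⟩) (Nat.lt_succ_self k)).eq
            have hbr := gen_braid (n := n) ⟨k, hk⟩ ⟨k + 1, h⟩ rfl
            have hx : gen ⟨k, hk⟩ ∈ initial n (k + 1) := gen_mem_initial (Nat.lt_succ_self k)
            have hle : initial n k ≤ initial n (k + 1) := initial_mono (Nat.le_succ k)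
            refine Or.inr ⟨h, a * c * gen ⟨k, hk⟩, mul_mem (mul_mem ha (hle hc)) hx,
              gen ⟨k, hk⟩ * d, mul_mem hx (hle hd), ?_⟩
            generalize (gen ⟨k + 1, h⟩ : BraidMonoid n) = y at *
            generalize (gen ⟨k, hk⟩ : BraidMonoid n) = x at *
            calc a * y * (c * x * d) * y = a * (y * c) * x * (d * y) := by simp only [mul_assoc]
              _ = a * c * (y * x * y) * d := by rw [hcc, ← hcd]; simp only [mul_assoc]
              _ = a * c * x * y * (x * d) := by rw [hbr]; simp only [mul_assoc]

theorem commute_proj_of_mem_initial {k : ℕ} {a : BraidMonoid n} (ha : a ∈ initial n k)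
    (l : List (Fin (n - 1))) (hl : ∀ i ∈ l, k < (i : ℕ)) :
    Commute (proj n (FreeMonoid.ofList l)) a := by
  induction l with
  | nil => exact Commute.one_left a
  | cons i l ih =>
    rw [FreeMonoid.ofList_cons, map_mul]
    exact (commute_gen_of_mem_initial ha (hl i (by simp))).mul_left
      (ih fun j hj => hl j (by simp [hj]))

/-- The list `l` accumulates the higher letters already isolated, while the induction on `k`
consumes `γ`. -/
theorem isLiterallySimple_mul {k : ℕ} (l : List (Fin (n - 1))) (hl : ∀ i ∈ l, k ≤ (i : ℕ))
    (hn : l.Nodup) {γ : BraidMonoid n} (hγ : γ ∈ initial n k)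
    (h : IsConjugateSimple (proj n (FreeMonoid.ofList l) * γ)) :
    IsLiterallySimple (proj n (FreeMonoid.ofList l) * γ) := by
  induction k generalizing l γ with
  | zero =>
    obtain rfl : γ = 1 := by simpa [initial_zero] using hγ
    exact ⟨FreeMonoid.ofList l, hn, (mul_one _).symm⟩
  | succ k ih =>
    have hsq : IsSquareFree γ := (h _ (IsConj.refl _)).of_divides
      ⟨proj n (FreeMonoid.ofList l), 1, by simp⟩
    rcases mem_initial_or_exists_eq hγ hsq with hk | ⟨hk, a, ha, b, hb, rfl⟩
    · exact ih l (fun i hi => (Nat.le_succ k).trans (hl i hi)) hn hk h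
    · have hcomm := (commute_proj_of_mem_initial ha l hl).eq
      have hword : proj n (FreeMonoid.ofList (l ++ [⟨k, hk⟩])) =
          proj n (FreeMonoid.ofList l) * gen ⟨k, hk⟩ := by
        rw [FreeMonoid.ofList_append, map_mul]
        rfl
      -- Conjugating by `a`, which commutes with all letters of `l`, moves it past `b` and puts the
      -- new letter next to `l`.
      have hconj : IsConj
          (toBraidGroup n (proj n (FreeMonoid.ofList (l ++ [⟨k, hk⟩])) * (b * a)))
          (toBraidGroup n (proj n (FreeMonoid.ofList l) * (a * gen ⟨k, hk⟩ * b))) := by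
        refine isConj_toBraidGroup (β := a) ?_
        rw [hword]
        generalize proj n (FreeMonoid.ofList l) = p at *
        simp only [← mul_assoc]
        rw [hcomm]
      refine IsLiterallySimple.of_isConj (ih _ ?_ ?_ (mul_mem hb ha) (h.of_isConj hconj.symm)) hconj
      · intro i hi
        rcases List.mem_append.1 hi with hi | hi
        · exact (Nat.le_succ k).trans (hl i hi)
        · simp [List.mem_singleton.1 hi]
      · refine List.nodup_append.2 ⟨hn, by simp, fun i hi j hj e => ?_⟩
        have hj' := List.mem_singleton.1 hj
        have := hl i hi
        rw [e, hj'] at this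
        simp at this

theorem IsConjugateSimple.isLiterallySimple {β : BraidMonoid n} (h : IsConjugateSimple β) :
    IsLiterallySimple β := by
  simpa using isLiterallySimple_mul [] (by simp) List.nodup_nil (mem_initial β) (by simpa using h)

end SimpleBraids

theorem mainTheorem3 (n : ℕ) :
    (∀ α β δ : SimpleBraids.BraidMonoid n, α ∈ SimpleBraids.LSB n →
      (α * β = β * δ → δ ∈ SimpleBraids.LSB n) ∧
      (β * α = δ * β → δ ∈ SimpleBraids.LSB n)) ∧
    SimpleBraids.LSB n = SimpleBraids.CSB n := by
  refine ⟨fun α β δ hα => ⟨fun h => ?_, fun h => ?_⟩, Set.ext fun β => ⟨fun h => ?_, fun h => ?_⟩⟩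
  · exact hα.of_isConj (SimpleBraids.isConj_toBraidGroup h.symm).symm
  · exact hα.of_isConj (SimpleBraids.isConj_toBraidGroup h)
  · exact fun β' hβ' => (h.of_isConj hβ').isSquareFree
  · exact h.isLiterallySimple
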